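/- Let $(X,d)$ be a proper geodesic Gromov hyperbolic metric space, and let $\Gamma$ be a finitely generated group acting on $X$ properly discontinuously by isometries. Let $\Lambda\subset\partial X$ be the limit set of $\Gamma$, i.e. the set of accumulation points in the Gromov boundary of the orbits of $\Gamma$. Assume that the action is non-elementary ($\Lambda$ has more than two points) and geometrically finite, i.e. every $\zeta\in\Lambda$ is either conical (for each geodesic ray $\gamma$ converging to $\zeta$ and each $x\in X$ there is $D>0$ such that $\gamma$ meets the $D$-neighbourhood of $\Gamma x$ at arbitrarily large times) or bounded parabolic (its stabilizer in $\Gamma$ is infinite and acts cocompactly and properly discontinuously on $\Lambda\setminus\{\zeta\}$). Let $\|\cdot\|$ be the word norm on $\Gamma$ with respect to a finite generating set, let $o\in X$, and let $P<\Gamma$ be a parabolic subgroup, i.e. a subgroup of the stabilizer of a bounded parabolic point. Then there are constants $c>1$ and $D>0$ such that $$\|g\|\ \ge\ D\,c^{\,d(o,go)}\qquad\text{for all } g\in P,\ g\neq e .$$ That is, parabolic subgroups are exponentially distorted in $X$. -/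

import Mathlib

open Filter Set

noncomputable section

namespace GromovHyp

/-! ### Geodesic Gromov hyperbolic spaces -/

/-- The Gromov product `(x | y)_o = (d(o,x) + d(o,y) - d(x,y)) / 2`. -/
def gromovProduct {X : Type*} [MetricSpace X] (o x y : X) : ℝ :=
  (dist o x + dist o y - dist x y) / 2

/-- A metric space is Gromov hyperbolic if for some `δ` the inequality
`(x | z)_o ≥ min ((x | y)_o) ((y | z)_o) - δ` holds for all points. -/
class IsGromovHyperbolic (X : Type*) [MetricSpace X] : Prop where
  exists_delta : ∃ δ : ℝ, ∀ o x y z : X,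
    min (gromovProduct o x y) (gromovProduct o y z) - δ ≤ gromovProduct o x z

/-- Any two points are joined by a geodesic segment. -/
class IsGeodesicSpace (X : Type*) [MetricSpace X] : Prop where
  exists_geodesic : ∀ x y : X, ∃ γ : ℝ → X, γ 0 = x ∧ γ (dist x y) = y ∧
    ∀ s ∈ Icc 0 (dist x y), ∀ t ∈ Icc 0 (dist x y), dist (γ s) (γ t) = |s - t|

/-- `γ`, restricted to `[0, ∞)`, is a geodesic ray. -/
def IsGeodesicRay {X : Type*} [MetricSpace X] (γ : ℝ → X) : Prop :=
  ∀ s t : ℝ, 0 ≤ s → 0 ≤ t → dist (γ s) (γ t) = |s - t|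

/-! ### The Gromov boundary -/

/-- `(x i | y j)_o → ∞` as `i, j → ∞` (for every base point `o`, equivalently for one). -/
def Asymptotic {X : Type*} [MetricSpace X] (x y : ℕ → X) : Prop :=
  ∀ o : X, Tendsto (fun p : ℕ × ℕ => gromovProduct o (x p.1) (y p.2)) atTop atTop

/-- Sequences converging at infinity: `(x i | x j)_o → ∞`. -/
def GromovSeq (X : Type*) [MetricSpace X] : Type _ :=
  {x : ℕ → X // Asymptotic x x}

theorem gromovProduct_comm {X : Type*} [MetricSpace X] (o x y : X) :
    gromovProduct o x y = gromovProduct o y x := by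
  unfold gromovProduct
  rw [dist_comm x y]
  ring

theorem gromovProduct_smul {Γ X : Type*} [MetricSpace X] [Group Γ] [MulAction Γ X]
    [IsIsometricSMul Γ X] (g : Γ) (o x y : X) :
    gromovProduct (g • o) (g • x) (g • y) = gromovProduct o x y := by
  simp [gromovProduct, dist_smul]

theorem Asymptotic.symm {X : Type*} [MetricSpace X] {x y : ℕ → X} (h : Asymptotic x y) :
    Asymptotic y x := by
  intro o
  rw [tendsto_atTop_atTop]
  intro b
  obtain ⟨⟨i, j⟩, h1⟩ := tendsto_atTop_atTop.1 (h o) b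
  refine ⟨(j, i), ?_⟩
  rintro ⟨p, q⟩ ⟨hp, hq⟩
  have h2 := h1 (q, p) ⟨hq, hp⟩
  rw [gromovProduct_comm]
  exact h2

theorem Asymptotic.trans {X : Type*} [MetricSpace X] [IsGromovHyperbolic X] {x y z : ℕ → X}
    (hxy : Asymptotic x y) (hyz : Asymptotic y z) : Asymptotic x z := by
  intro o
  obtain ⟨δ, hδ⟩ := IsGromovHyperbolic.exists_delta (X := X)
  rw [tendsto_atTop_atTop]
  intro b
  obtain ⟨⟨i1, j1⟩, h1⟩ := tendsto_atTop_atTop.1 (hxy o) (b + δ)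
  obtain ⟨⟨i2, j2⟩, h2⟩ := tendsto_atTop_atTop.1 (hyz o) (b + δ)
  refine ⟨(i1, j2), ?_⟩
  rintro ⟨i, j⟩ ⟨hi, hj⟩
  have a1 := h1 (i, max j1 i2) ⟨hi, le_max_left _ _⟩
  have a2 := h2 (max j1 i2, j) ⟨le_max_right _ _, hj⟩
  have a3 := hδ o (x i) (y (max j1 i2)) (z j)
  have a4 := le_min a1 a2
  dsimp only at a4 ⊢
  linarith

theorem Asymptotic.smul {Γ X : Type*} [MetricSpace X] [Group Γ] [MulAction Γ X]
    [IsIsometricSMul Γ X] (g : Γ) {x y : ℕ → X} (h : Asymptotic x y) :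
    Asymptotic (fun n => g • x n) (fun n => g • y n) := by
  intro o
  refine (h (g⁻¹ • o)).congr fun p => ?_
  rw [← gromovProduct_smul g, smul_inv_smul]

instance gromovSetoid (X : Type*) [MetricSpace X] [IsGromovHyperbolic X] :
    Setoid (GromovSeq X) where
  r x y := Asymptotic x.1 y.1
  iseqv := ⟨fun x => x.2, fun h => h.symm, fun h h' => h.trans h'⟩

/-- The Gromov boundary `∂X`: classes of sequences converging at infinity. -/
def Boundary (X : Type*) [MetricSpace X] [IsGromovHyperbolic X] : Type _ :=
  Quotient (gromovSetoid X)

/-- The sequence `x` in `X` converges to the boundary point `ζ`. -/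
def ConvergesTo {X : Type*} [MetricSpace X] [IsGromovHyperbolic X] (x : ℕ → X)
    (ζ : Boundary X) : Prop :=
  ∃ h : Asymptotic x x, (Quotient.mk (gromovSetoid X) ⟨x, h⟩ : Boundary X) = ζ

/-- The Gromov product of two boundary points,
`(ζ | η)_o = inf liminf_{i,j} (x i | y j)_o` over all sequences `x → ζ`, `y → η`. -/
def boundaryProduct {X : Type*} [MetricSpace X] [IsGromovHyperbolic X] (o : X)
    (ζ η : Boundary X) : EReal :=
  ⨅ (x : ℕ → X) (_ : ConvergesTo x ζ) (y : ℕ → X) (_ : ConvergesTo y η),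
    liminf (fun p : ℕ × ℕ => ((gromovProduct o (x p.1) (y p.2) : ℝ) : EReal)) atTop

/-- The usual topology of `∂X`: the sets `{η | (ζ | η)_o > R}` form a basis of (not necessarily
open) neighbourhoods of `ζ`. -/
instance boundaryTopology (X : Type*) [MetricSpace X] [IsGromovHyperbolic X] :
    TopologicalSpace (Boundary X) where
  IsOpen U := ∀ ζ ∈ U, ∀ o : X, ∃ R : ℝ, ∀ η : Boundary X,
    (R : EReal) < boundaryProduct o ζ η → η ∈ U
  isOpen_univ := fun _ _ _ => ⟨0, fun _ _ => mem_univ _⟩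
  isOpen_inter := by
    intro U V hU hV ζ hζ o
    obtain ⟨R, hR⟩ := hU ζ hζ.1 o
    obtain ⟨S, hS⟩ := hV ζ hζ.2 o
    refine ⟨max R S, fun η hη => ⟨hR η ?_, hS η ?_⟩⟩
    · exact lt_of_le_of_lt (EReal.coe_le_coe_iff.2 (le_max_left R S)) hη
    · exact lt_of_le_of_lt (EReal.coe_le_coe_iff.2 (le_max_right R S)) hη
  isOpen_sUnion := by
    intro s hs ζ hζ o
    obtain ⟨U, hU, hζU⟩ := hζ
    obtain ⟨R, hR⟩ := hs U hU ζ hζU o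
    exact ⟨R, fun η hη => ⟨U, hU, hR η hη⟩⟩

/-- The action of `Γ` on `∂X` induced by an isometric action on `X`: `g • [x n] = [g • x n]`. -/
instance boundaryAction (Γ X : Type*) [MetricSpace X] [IsGromovHyperbolic X] [Group Γ]
    [MulAction Γ X] [IsIsometricSMul Γ X] : MulAction Γ (Boundary X) where
  smul g := Quotient.map (fun x : GromovSeq X => ⟨fun n => g • x.1 n, x.2.smul g⟩)
    (fun _ _ h => Asymptotic.smul g h)
  one_smul := by
    intro ζ
    induction ζ using Quotient.inductionOn with
    | h x =>
      refine congrArg (Quotient.mk (gromovSetoid X)) (Subtype.ext ?_)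
      funext n
      exact one_smul Γ (x.1 n)
  mul_smul := by
    intro g h ζ
    induction ζ using Quotient.inductionOn with
    | h x =>
      refine congrArg (Quotient.mk (gromovSetoid X)) (Subtype.ext ?_)
      funext n
      exact mul_smul g h (x.1 n)

/-! ### Limit set, conical points, bounded parabolic points, geometrical finiteness -/

/-- The limit set `Λ`: the accumulation points in `∂X` of the orbits of `Γ`. -/
def limitSet (Γ X : Type*) [MetricSpace X] [IsGromovHyperbolic X] [Group Γ] [MulAction Γ X] :
    Set (Boundary X) :=
  {ζ | ∃ (x : X) (g : ℕ → Γ), ConvergesTo (fun n => g n • x) ζ}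

/-- The action is non-elementary: its limit set has more than two points. -/
def IsNonelementary (Γ X : Type*) [MetricSpace X] [IsGromovHyperbolic X] [Group Γ]
    [MulAction Γ X] : Prop :=
  2 < (limitSet Γ X).encard

/-- `ζ` is a conical limit point: each geodesic ray converging to `ζ` returns, at arbitrarily large
times, to some `D`-neighbourhood of each orbit. -/
def IsConical (Γ : Type*) {X : Type*} [MetricSpace X] [IsGromovHyperbolic X] [Group Γ]
    [MulAction Γ X] (ζ : Boundary X) : Prop :=
  ζ ∈ limitSet Γ X ∧
  ∀ γ : ℝ → X, IsGeodesicRay γ → ConvergesTo (fun n : ℕ => γ n) ζ →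
    ∀ x : X, ∃ D : ℝ, 0 < D ∧ ∀ T : ℝ, ∃ t : ℝ, T ≤ t ∧ 0 ≤ t ∧ ∃ g : Γ, dist (γ t) (g • x) < D

/-- `ζ` is a bounded parabolic point: it is a limit point whose stabilizer in `Γ` is infinite and
acts properly discontinuously and cocompactly on `Λ \ {ζ}`. -/
def IsBoundedParabolic (Γ : Type*) {X : Type*} [MetricSpace X] [IsGromovHyperbolic X] [Group Γ]
    [MulAction Γ X] [IsIsometricSMul Γ X] (ζ : Boundary X) : Prop :=
  ζ ∈ limitSet Γ X ∧
  (MulAction.stabilizer Γ ζ : Set Γ).Infinite ∧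
  (∀ K L : Set (Boundary X), IsCompact K → IsCompact L →
    K ⊆ limitSet Γ X \ {ζ} → L ⊆ limitSet Γ X \ {ζ} →
    {g : Γ | g ∈ MulAction.stabilizer Γ ζ ∧ ((fun η => g • η) '' K ∩ L).Nonempty}.Finite) ∧
  (∃ K : Set (Boundary X), IsCompact K ∧ K ⊆ limitSet Γ X \ {ζ} ∧
    limitSet Γ X \ {ζ} ⊆ ⋃ g ∈ MulAction.stabilizer Γ ζ, (fun η => g • η) '' K)

/-- Every limit point is conical or bounded parabolic. -/
def IsGeometricallyFinite (Γ X : Type*) [MetricSpace X] [IsGromovHyperbolic X] [Group Γ]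
    [MulAction Γ X] [IsIsometricSMul Γ X] : Prop :=
  ∀ ζ ∈ limitSet Γ X, IsConical Γ ζ ∨ IsBoundedParabolic Γ ζ

/-- A parabolic subgroup: a subgroup of a maximal parabolic one, the latter being the stabilizers
of the (bounded) parabolic points. -/
def IsParabolicSubgroup {Γ : Type*} (X : Type*) [MetricSpace X] [IsGromovHyperbolic X] [Group Γ]
    [MulAction Γ X] [IsIsometricSMul Γ X] (P : Subgroup Γ) : Prop :=
  ∃ ζ : Boundary X, IsBoundedParabolic Γ ζ ∧ P ≤ MulAction.stabilizer Γ ζ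

/-- The word norm of `g` for the generating set `S`: the least length of a word in the elements of
`S` and their inverses that represents `g`. -/
def wordNorm {Γ : Type*} [Group Γ] (S : Set Γ) (g : Γ) : ℕ :=
  sInf {n : ℕ | ∃ l : List Γ, (∀ s ∈ l, s ∈ S ∨ s⁻¹ ∈ S) ∧ l.prod = g ∧ l.length = n}

end GromovHyp

end

/-! Let `β` be a horofunction at the parabolic point `ζ`. Elements of the stabilizer change `β` by a
bounded amount: one pushing `o` far from `ζ` would have infinitely many powers fixing a second limit
point, against proper discontinuity on `Λ \ {ζ}`.

The whole orbit `Γ o` avoids a horoball at `ζ`. By cocompactness on `Λ \ {ζ}`, a deep orbit point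
can be moved next to a ray from `o` to `ζ`. There arbitrarily many stabilizer elements displace it
boundedly, which contradicts proper discontinuity on `X`.

A word of length `n` is thus a chain of bounded steps outside a horoball. The Gromov product based
at `ζ` obeys the four-point inequality, so dyadic subdivision of the chain loses only `δ * log₂ n`.
As `β` is bounded on `P o`, this gives `d(o, g o) ≤ C + 2 (δ + 1) log₂ n`, rounding the logarithm
up. -/

namespace GromovHyp

open Topology

/-! ### Four-point inequality and asymptotic sequences -/

section Hyperbolicity

variable {X : Type*} [MetricSpace X]

/-- The four-point inequality with a fixed constant `δ`. -/
def FourPoint (X : Type*) [MetricSpace X] (δ : ℝ) : Prop :=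
  ∀ o x y z : X, min (gromovProduct o x y) (gromovProduct o y z) - δ ≤ gromovProduct o x z

theorem FourPoint.nonneg {δ : ℝ} (h : FourPoint X δ) (o : X) : 0 ≤ δ := by
  have := h o o o o
  simp [gromovProduct] at this
  exact this

theorem gromovProduct_sub_dist_le (o q x y : X) :
    gromovProduct o x y - dist o q ≤ gromovProduct q x y := by
  unfold gromovProduct
  linarith [dist_triangle o q x, dist_triangle o q y]

theorem asymptotic_of_basepoint {x y : ℕ → X} (o : X)
    (h : Tendsto (fun p : ℕ × ℕ => gromovProduct o (x p.1) (y p.2)) atTop atTop) :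
    Asymptotic x y := fun q =>
  tendsto_atTop_mono (fun p => gromovProduct_sub_dist_le o q (x p.1) (y p.2))
    (tendsto_atTop_add_const_right _ (-dist o q) h)

theorem Asymptotic.exists_le {x y : ℕ → X} (h : Asymptotic x y) (o : X) (R : ℝ) :
    ∃ N, ∀ i j, N ≤ i → N ≤ j → R ≤ gromovProduct o (x i) (y j) := by
  obtain ⟨⟨a, b⟩, hab⟩ := tendsto_atTop_atTop.1 (h o) R
  exact ⟨max a b, fun i j hi hj =>
    hab (i, j) ⟨(le_max_left _ _).trans hi, (le_max_right _ _).trans hj⟩⟩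

theorem asymptotic_of_exists_le {x y : ℕ → X} (o : X)
    (h : ∀ R : ℝ, ∃ N, ∀ i j, N ≤ i → N ≤ j → R ≤ gromovProduct o (x i) (y j)) :
    Asymptotic x y := by
  refine asymptotic_of_basepoint o (tendsto_atTop_atTop.2 fun R => ?_)
  obtain ⟨N, hN⟩ := h R
  exact ⟨(N, N), fun p hp => hN p.1 p.2 hp.1 hp.2⟩

end Hyperbolicity

/-! ### Nearness of boundary points -/

section Boundary

variable {X : Type*} [MetricSpace X] [IsGromovHyperbolic X]

theorem exists_convergesTo (ξ : Boundary X) : ∃ x, ConvergesTo x ξ := by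
  induction ξ using Quotient.inductionOn with
  | h x => exact ⟨x.1, x.2, rfl⟩

theorem ConvergesTo.asymptotic {x y : ℕ → X} {ξ : Boundary X}
    (hx : ConvergesTo x ξ) (hy : ConvergesTo y ξ) : Asymptotic x y := by
  obtain ⟨h, rfl⟩ := hx
  obtain ⟨h', e⟩ := hy
  exact (Quotient.exact e.symm : Asymptotic x y)

theorem ConvergesTo.eq_of_asymptotic {x y : ℕ → X} {ξ η : Boundary X}
    (hx : ConvergesTo x ξ) (hy : ConvergesTo y η) (h : Asymptotic x y) : ξ = η := by
  obtain ⟨h1, rfl⟩ := hx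
  obtain ⟨h2, rfl⟩ := hy
  exact Quotient.sound h

theorem ConvergesTo.smul {Γ : Type*} [Group Γ] [MulAction Γ X] [IsIsometricSMul Γ X] (g : Γ)
    {x : ℕ → X} {ξ : Boundary X} (h : ConvergesTo x ξ) :
    ConvergesTo (fun n => g • x n) (g • ξ) := by
  obtain ⟨h, rfl⟩ := h
  exact ⟨h.smul g, rfl⟩

theorem smul_mem_limitSet {Γ : Type*} [Group Γ] [MulAction Γ X] [IsIsometricSMul Γ X] (g : Γ)
    {ξ : Boundary X} (h : ξ ∈ limitSet Γ X) : g • ξ ∈ limitSet Γ X := by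
  obtain ⟨x, f, hf⟩ := h
  refine ⟨x, fun n => g * f n, ?_⟩
  simpa only [mul_smul] using hf.smul g

/-- Sequences converging to `ξ` and `η` eventually have Gromov product at least `R`. -/
def BoundaryNear (o : X) (R : ℝ) (ξ η : Boundary X) : Prop :=
  ∀ x y : ℕ → X, ConvergesTo x ξ → ConvergesTo y η →
    ∃ N, ∀ i j, N ≤ i → N ≤ j → R ≤ gromovProduct o (x i) (y j)

theorem BoundaryNear.refl (o : X) (R : ℝ) (ξ : Boundary X) : BoundaryNear o R ξ ξ :=
  fun _ _ hx hy => (hx.asymptotic hy).exists_le o R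

theorem BoundaryNear.symm {o : X} {R : ℝ} {ξ η : Boundary X} (h : BoundaryNear o R ξ η) :
    BoundaryNear o R η ξ := by
  intro x y hx hy
  obtain ⟨N, hN⟩ := h y x hy hx
  exact ⟨N, fun i j hi hj => by rw [gromovProduct_comm]; exact hN j i hj hi⟩

theorem BoundaryNear.mono {o : X} {R S : ℝ} {ξ η : Boundary X} (h : BoundaryNear o R ξ η)
    (hS : S ≤ R) : BoundaryNear o S ξ η := by
  intro x y hx hy
  obtain ⟨N, hN⟩ := h x y hx hy
  exact ⟨N, fun i j hi hj => hS.trans (hN i j hi hj)⟩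

theorem BoundaryNear.trans {δ : ℝ} (hδ : FourPoint X δ) {o : X} {R : ℝ} {ξ ω η : Boundary X}
    (h : BoundaryNear o R ξ ω) (h' : BoundaryNear o R ω η) : BoundaryNear o (R - δ) ξ η := by
  intro x y hx hy
  obtain ⟨w, hw⟩ := exists_convergesTo ω
  obtain ⟨N, hN⟩ := h x w hx hw
  obtain ⟨M, hM⟩ := h' w y hw hy
  refine ⟨max N M, fun i j hi hj => ?_⟩
  have h1 := hN i (max N M) ((le_max_left _ _).trans hi) (le_max_left _ _)
  have h2 := hM (max N M) j (le_max_right _ _) ((le_max_right _ _).trans hj)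
  linarith [hδ o (x i) (w (max N M)) (y j), le_min h1 h2]

theorem BoundaryNear.change_base {o : X} (q : X) {R : ℝ} {ξ η : Boundary X}
    (h : BoundaryNear o R ξ η) : BoundaryNear q (R - dist o q) ξ η := by
  intro x y hx hy
  obtain ⟨N, hN⟩ := h x y hx hy
  exact ⟨N, fun i j hi hj => by
    linarith [hN i j hi hj, gromovProduct_sub_dist_le o q (x i) (y j)]⟩

theorem BoundaryNear.smul {Γ : Type*} [Group Γ] [MulAction Γ X] [IsIsometricSMul Γ X] (g : Γ)
    {o : X} {R : ℝ} {ξ η : Boundary X} (h : BoundaryNear o R ξ η) :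
    BoundaryNear (g • o) R (g • ξ) (g • η) := by
  intro x y hx hy
  obtain ⟨N, hN⟩ := h _ _ (by simpa using hx.smul g⁻¹) (by simpa using hy.smul g⁻¹)
  refine ⟨N, fun i j hi hj => ?_⟩
  have := hN i j hi hj
  rwa [← gromovProduct_smul g, smul_inv_smul, smul_inv_smul] at this

theorem exists_not_boundaryNear (o : X) {ξ η : Boundary X} (h : ξ ≠ η) :
    ∃ R, ¬ BoundaryNear o R ξ η := by
  by_contra! hc
  obtain ⟨x, hx⟩ := exists_convergesTo ξ
  obtain ⟨y, hy⟩ := exists_convergesTo η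
  exact h (hx.eq_of_asymptotic hy (asymptotic_of_exists_le o fun R => hc R x y hx hy))

/-- Changing the two representing sequences costs one `δ` each, so small products along one pair of
sequences bound the products along every pair. -/
theorem exists_gromovProduct_le_of_not_boundaryNear {δ : ℝ} (hδ : FourPoint X δ) {o : X} {R : ℝ}
    {ξ η : Boundary X} (h : ¬ BoundaryNear o R ξ η) {x y : ℕ → X} (hx : ConvergesTo x ξ)
    (hy : ConvergesTo y η) :
    ∃ N, ∀ i j, N ≤ i → N ≤ j → gromovProduct o (x i) (y j) ≤ R + 2 * δ := by
  have h0 := hδ.nonneg o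
  unfold BoundaryNear at h
  push Not at h
  obtain ⟨x', y', hx', hy', h⟩ := h
  obtain ⟨N, hN⟩ := (hx'.asymptotic hx).exists_le o (R + 2 * δ)
  obtain ⟨M, hM⟩ := (hy.asymptotic hy').exists_le o (R + 2 * δ)
  refine ⟨max N M, fun i j hi hj => ?_⟩
  by_contra! hc
  obtain ⟨i', j', hi', hj', hlt⟩ := h (max N M)
  have h1 := hN i' i ((le_max_left _ _).trans hi') ((le_max_left _ _).trans hi)
  have h2 := hM j j' ((le_max_right _ _).trans hj) ((le_max_right _ _).trans hj')
  have h3 := hδ o (x' i') (x i) (y j)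
  have h4 := hδ o (x' i') (y j) (y' j')
  have h5 := le_min h1 hc.le
  have h6 : R + δ ≤ gromovProduct o (x' i') (y j) := by linarith
  have h7 := le_min h6 (show R + δ ≤ gromovProduct o (y j) (y' j') by linarith)
  linarith

theorem boundaryNear_of_lt_boundaryProduct {o : X} {R : ℝ} {ξ η : Boundary X}
    (h : (R : EReal) < boundaryProduct o ξ η) : BoundaryNear o R ξ η := by
  intro x y hx hy
  have h1 : (R : EReal) <
      liminf (fun p : ℕ × ℕ => ((gromovProduct o (x p.1) (y p.2) : ℝ) : EReal)) atTop :=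
    h.trans_le ((iInf₂_le x hx).trans (iInf₂_le y hy))
  obtain ⟨⟨a, b⟩, hab⟩ := eventually_atTop.1 (eventually_lt_of_lt_liminf h1)
  refine ⟨max a b, fun i j hi hj => ?_⟩
  exact (EReal.coe_lt_coe_iff.1
    (hab (i, j) ⟨(le_max_left _ _).trans hi, (le_max_right _ _).trans hj⟩)).le

/-- A compact set of boundary points avoiding `ζ` stays uniformly away from `ζ`. -/
theorem exists_forall_not_boundaryNear_of_isCompact (o : X) {ζ : Boundary X}
    {K : Set (Boundary X)} (hK : IsCompact K) (hζ : ζ ∉ K) :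
    ∃ R, ∀ η ∈ K, ¬ BoundaryNear o R ζ η := by
  obtain ⟨δ, hδ⟩ : ∃ δ, FourPoint X δ := IsGromovHyperbolic.exists_delta
  -- Asking for a whole `S`-neighbourhood that is not `R`-near `ζ` makes these sets open; they
  -- increase with `R`, so one of them contains `K`.
  let U : ℝ → Set (Boundary X) := fun R =>
    {ξ | ∃ S, ∀ ω, BoundaryNear o S ξ ω → ¬ BoundaryNear o R ζ ω}
  have hUo : ∀ R, IsOpen (U R) := by
    rintro R ξ ⟨S, hS⟩ q
    refine ⟨S + δ + dist q o, fun ξ' hξ' => ⟨S + δ, fun ω hω => hS ω ?_⟩⟩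
    have h1 := (boundaryNear_of_lt_boundaryProduct hξ').change_base o
    exact ((h1.mono (by linarith)).trans hδ hω).mono (by linarith)
  have hmono : Monotone U := by
    rintro R R' hR ξ ⟨S, hS⟩
    exact ⟨S, fun ω hω hn => hS ω hω (hn.mono hR)⟩
  have hcov : K ⊆ ⋃ R, U R := by
    intro ξ hξ
    obtain ⟨R, hR⟩ := exists_not_boundaryNear o (show ζ ≠ ξ from fun e => hζ (e ▸ hξ))
    refine mem_iUnion.2 ⟨R + δ, R + δ, fun ω h1 h2 => hR ?_⟩
    exact (h2.trans hδ h1.symm).mono (by linarith)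
  obtain ⟨R, hR⟩ := hK.elim_directed_cover U hUo hcov hmono.directed_le
  refine ⟨R, fun η hη => ?_⟩
  obtain ⟨S, hS⟩ := hR hη
  exact hS η (BoundaryNear.refl o S η)

end Boundary

/-! ### Horofunctions and the Gromov product based at infinity -/

section Horofunction

variable {X : Type*} [MetricSpace X]

/-- Since `(y | w)_x ≤ d(x, y) ≤ (z | w)_x`, the four-point inequality gives `(y | z)_x ≥ (y | w)_x
- δ`. Hence horofunctions at one boundary point agree coarsely. -/
theorem sub_sub_sub_le_of_gromovProduct {δ : ℝ} (hδ : FourPoint X δ) (x y z w : X)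
    (h : dist x y ≤ gromovProduct x z w) :
    dist y z - dist x z - (dist y w - dist x w) ≤ 2 * δ := by
  have h1 := hδ x y z w
  have h2 := hδ x y w z
  have h3 : gromovProduct x y w ≤ dist x y := by
    unfold gromovProduct; linarith [dist_triangle x y w]
  have h4 := le_min (le_refl (gromovProduct x y w)) (h3.trans h)
  rw [gromovProduct_comm x z w] at h4
  simp only [gromovProduct] at *
  linarith

/-- `β` is the horofunction normalized at `o` of the sequence `z`, as a limit along the filter
`U`. -/
structure IsHorofunction (o : X) (z : ℕ → X) (U : Filter ℕ) (β : X → ℝ) : Prop where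
  neBot : U.NeBot
  le_atTop : U ≤ atTop
  tendsto : ∀ x, Tendsto (fun m => dist x (z m) - dist o (z m)) U (𝓝 (β x))

/-- The differences are bounded by `d(x, o)`, so a single ultrafilter gives limits at all `x` at
once. -/
theorem exists_isHorofunction (o : X) (z : ℕ → X) : ∃ U β, IsHorofunction o z U β := by
  have h : ∀ x, ∃ b, Tendsto (fun m => dist x (z m) - dist o (z m))
      (hyperfilter ℕ : Filter ℕ) (𝓝 b) := by
    intro x
    have hc : IsCompact (Icc (-dist x o) (dist x o)) := isCompact_Icc
    obtain ⟨b, -, hb⟩ := hc.ultrafilter_le_nhds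
      ((hyperfilter ℕ).map fun m => dist x (z m) - dist o (z m)) (by
        refine le_principal_iff.2 (mem_map.2 (univ_mem' fun m => ?_))
        simp only [mem_preimage, mem_Icc]
        constructor
        · linarith [dist_triangle o x (z m), dist_comm x o]
        · linarith [dist_triangle x o (z m)])
    exact ⟨b, hb⟩
  choose β hβ using h
  exact ⟨_, β, inferInstance, Nat.hyperfilter_le_atTop, hβ⟩

/-- The Gromov product based at the center of the horofunction `β`. -/
noncomputable def horoProduct (β : X → ℝ) (x y : X) : ℝ := (β x + β y - dist x y) / 2

namespace IsHorofunction

variable {o : X} {z : ℕ → X} {U : Filter ℕ} {β : X → ℝ}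

theorem apply_base (h : IsHorofunction o z U β) : β o = 0 := by
  have := h.neBot
  refine tendsto_nhds_unique (h.tendsto o) ?_
  simp

theorem sub_le_dist (h : IsHorofunction o z U β) (x y : X) : β x - β y ≤ dist x y := by
  have := h.neBot
  refine le_of_tendsto' ((h.tendsto x).sub (h.tendsto y)) fun m => ?_
  linarith [dist_triangle x y (z m)]

/-- After subtracting `d(o, z m)`, the Gromov products based at `z m` converge to `horoProduct`; the
four-point inequality survives with the same `δ`. -/
theorem min_horoProduct_sub_le {δ : ℝ} (hδ : FourPoint X δ) (h : IsHorofunction o z U β)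
    (x y w : X) : min (horoProduct β x y) (horoProduct β y w) - δ ≤ horoProduct β x w := by
  have := h.neBot
  have key : ∀ a b, Tendsto (fun m => gromovProduct (z m) a b - dist o (z m)) U
      (𝓝 (horoProduct β a b)) := by
    intro a b
    refine ((((h.tendsto a).add (h.tendsto b)).sub_const (dist a b)).div_const 2).congr
      fun m => ?_
    simp only [gromovProduct, dist_comm (z m)]
    ring
  refine le_of_tendsto_of_tendsto' (((key x y).min (key y w)).sub_const δ) (key x w) fun m => ?_
  rw [min_sub_sub_right]
  linarith [hδ (z m) x y w]

/-- Dyadic subdivision of a chain of points. -/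
theorem le_horoProduct_chain {δ : ℝ} (hδ : FourPoint X δ) (h : IsHorofunction o z U β)
    {A : ℝ} (f : ℕ → X) (h0 : ∀ i, A ≤ β (f i))
    (h1 : ∀ i, A ≤ horoProduct β (f i) (f (i + 1))) (k : ℕ) :
    ∀ a n, n ≤ 2 ^ k → A - k * δ ≤ horoProduct β (f a) (f (a + n)) := by
  induction k with
  | zero =>
    intro a n hn
    have : n = 0 ∨ n = 1 := by simp at hn; omega
    rcases this with rfl | rfl
    · simpa [horoProduct] using h0 a
    · simpa using h1 a
  | succ k ih =>
    intro a n hn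
    rw [pow_succ] at hn
    have e1 := ih a (n / 2) (by omega)
    have e2 := ih (a + n / 2) (n - n / 2) (by omega)
    rw [show a + n / 2 + (n - n / 2) = a + n by omega] at e2
    have e3 := h.min_horoProduct_sub_le hδ (f a) (f (a + n / 2)) (f (a + n))
    push_cast
    linarith [le_min e1 e2]

/-- A chain moving away from the center fast enough. -/
theorem le_horoProduct_escaping {δ D : ℝ} (hδ : FourPoint X δ) (h : IsHorofunction o z U β)
    (x : ℕ → X) (hx : ∀ n, β (x n) + δ ≤ β (x (n + 1)))
    (hD : ∀ n, dist (x n) (x (n + 1)) ≤ D) (k : ℕ) :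
    ∀ n, β (x n) - D - δ ≤ horoProduct β (x n) (x (n + k)) := by
  have hδ0 := hδ.nonneg o
  have hD0 : 0 ≤ D := dist_nonneg.trans (hD 0)
  induction k with
  | zero =>
    intro n
    simp only [horoProduct, add_zero, dist_self]
    linarith
  | succ k ih =>
    intro n
    have e1 := ih (n + 1)
    rw [show n + 1 + k = n + (k + 1) by omega] at e1
    have e2 : β (x n) - D ≤ horoProduct β (x n) (x (n + 1)) := by
      unfold horoProduct
      linarith [hx n, hD n]
    -- The gain of `δ` in `β` at each step pays for the `δ` lost in the induction, so losses do not
    -- accumulate.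
    have e3 := h.min_horoProduct_sub_le hδ (x n) (x (n + 1)) (x (n + (k + 1)))
    have e4 : β (x n) - D ≤ horoProduct β (x (n + 1)) (x (n + (k + 1))) := by linarith [hx n]
    linarith [le_min e2 e4]

/-- Points close to a ray from `o` to `ζ` and far away are moved a bounded amount. -/
theorem dist_smul_le {Γ : Type*} [Group Γ] [MulAction Γ X] [IsIsometricSMul Γ X] {δ : ℝ}
    (hδ : FourPoint X δ) (h : IsHorofunction o z U β)
    {p : Γ} {E c : ℝ} (hE : ∀ x, |β (p • x) - β x| ≤ E) {y : X} (hy : β y + dist o y ≤ c)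
    (hc : 0 ≤ c) (hyp : β y ≤ -dist o (p • o)) : dist y (p • y) ≤ 3 * E + c + 4 * δ := by
  have hδ0 := hδ.nonneg o
  have hb := h.apply_base
  have hEo := abs_le.1 (hE o)
  have hEy := abs_le.1 (hE y)
  have hd : (0 : ℝ) ≤ dist o (p • o) := dist_nonneg
  -- The chain `y, o, p • o, p • y` has three links with this lower bound; joining them costs `2 *
  -- δ`.
  have e1 : β y - E - c / 2 ≤ horoProduct β y o := by
    unfold horoProduct; linarith [dist_comm y o]
  have e2 : β y - E - c / 2 ≤ horoProduct β o (p • o) := by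
    unfold horoProduct; linarith
  have e3 : β y - E - c / 2 ≤ horoProduct β (p • o) (p • y) := by
    unfold horoProduct; rw [dist_smul]; linarith
  have e4 := h.min_horoProduct_sub_le hδ y o (p • o)
  have e5 := h.min_horoProduct_sub_le hδ y (p • o) (p • y)
  have e6 := le_min e1 e2
  have e7 := le_min (show β y - E - c / 2 - δ ≤ horoProduct β y (p • o) by linarith)
    (show β y - E - c / 2 - δ ≤ horoProduct β (p • o) (p • y) by linarith)
  have e8 : β y - E - c / 2 - 2 * δ ≤ horoProduct β y (p • y) := by linarith
  unfold horoProduct at e8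
  linarith

end IsHorofunction

end Horofunction

/-! ### Coarse invariance of horofunctions under the stabilizer -/

section Stabilizer

variable {X Γ : Type*} [MetricSpace X] [IsGromovHyperbolic X] [Group Γ] [MulAction Γ X]
  [IsIsometricSMul Γ X] {o : X} {z : ℕ → X} {U : Filter ℕ} {β : X → ℝ} {ζ : Boundary X} {δ : ℝ}

/-- Translating by `p` replaces `z` by `p⁻¹ • z`, which also converges to `ζ`. -/
theorem IsHorofunction.smul_sub_smul_le (hδ : FourPoint X δ) (h : IsHorofunction o z U β)
    (hz : ConvergesTo z ζ) {p : Γ} (hp : p ∈ MulAction.stabilizer Γ ζ) (x y : X) :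
    β (p • y) - β (p • x) - (β y - β x) ≤ 2 * δ := by
  have := h.neBot
  have hz' : ConvergesTo (fun n => p⁻¹ • z n) ζ := by
    have := hz.smul p⁻¹
    rwa [MulAction.mem_stabilizer_iff.1 (inv_mem hp)] at this
  obtain ⟨N, hN⟩ := (hz'.asymptotic hz).exists_le x (dist x y)
  refine le_of_tendsto (((h.tendsto (p • y)).sub (h.tendsto (p • x))).sub
    ((h.tendsto y).sub (h.tendsto x))) ?_
  filter_upwards [h.le_atTop (eventually_ge_atTop N)] with m hm
  have e := sub_sub_sub_le_of_gromovProduct hδ x y (p⁻¹ • z m) (z m) (hN m m hm hm)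
  have e1 : ∀ a : X, dist a (p⁻¹ • z m) = dist (p • a) (z m) := fun a => by
    rw [← dist_smul p, smul_inv_smul]
  rw [e1, e1] at e
  linarith

/-- Otherwise `β` grows by at least `δ + 1` at each step along `p ^ n • o`, which then converges to
a limit point other than `ζ` fixed by all powers of `p`. -/
theorem IsHorofunction.apply_smul_le_of_isBoundedParabolic (hδ : FourPoint X δ)
    (h : IsHorofunction o z U β) (hz : ConvergesTo z ζ) (hζ : IsBoundedParabolic Γ ζ) {p : Γ}
    (hp : p ∈ MulAction.stabilizer Γ ζ) : β (p • o) ≤ 3 * δ + 1 := by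
  by_contra! hc
  have hδ0 := hδ.nonneg o
  have hneBot := h.neBot
  let x : ℕ → X := fun n => p ^ n • o
  have hxs : ∀ n, x (n + 1) = p ^ n • p • o := fun n => by simp only [x, pow_succ, mul_smul]
  have hx : ∀ n, β (x n) + (δ + 1) ≤ β (x (n + 1)) := by
    intro n
    have e := h.smul_sub_smul_le hδ hz (inv_mem (pow_mem hp n)) (x n) (x (n + 1))
    rw [hxs, inv_smul_smul] at e
    rw [hxs]
    simp only [x, inv_smul_smul, h.apply_base] at *
    linarith
  have hD : ∀ n, dist (x n) (x (n + 1)) ≤ dist o (p • o) := fun n => by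
    rw [hxs, dist_smul]
  have hgrow : ∀ n : ℕ, (n : ℝ) ≤ β (x n) := by
    intro n
    induction n with
    | zero => simp [x, h.apply_base]
    | succ n ih => push_cast; linarith [hx n]
  have hch := fun k n => h.le_horoProduct_escaping hδ x (fun n => by linarith [hx n]) hD k n
  have hcomp : ∀ a b, horoProduct β a b ≤ gromovProduct o a b := by
    intro a b
    have e1 := h.sub_le_dist a o
    have e2 := h.sub_le_dist b o
    rw [h.apply_base, dist_comm] at e1 e2
    unfold horoProduct gromovProduct
    linarith
  have hprod : ∀ i j N : ℕ, N ≤ i → N ≤ j →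
      (N : ℝ) - dist o (p • o) - δ ≤ gromovProduct o (x i) (x j) := by
    have aux : ∀ i j N : ℕ, N ≤ i → i ≤ j →
        (N : ℝ) - dist o (p • o) - δ ≤ gromovProduct o (x i) (x j) := by
      intro i j N hN hij
      obtain ⟨k, rfl⟩ := Nat.exists_eq_add_of_le hij
      have hN' : (N : ℝ) ≤ i := by exact_mod_cast hN
      linarith [hch k i, hgrow i, hcomp (x i) (x (i + k))]
    intro i j N hi hj
    rcases le_total i j with hij | hij
    · exact aux i j N hi hij
    · rw [gromovProduct_comm]
      exact aux j i N hj hij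
  have hasym : ∀ s : ℕ, Asymptotic x (fun n => x (n + s)) := by
    intro s
    refine asymptotic_of_exists_le o fun R => ?_
    obtain ⟨N, hN⟩ := exists_nat_ge (R + dist o (p • o) + δ)
    exact ⟨N, fun i j hi hj => by linarith [hprod i (j + s) N hi (by omega)]⟩
  let η : Boundary X := Quotient.mk (gromovSetoid X) ⟨x, hasym 0⟩
  have hxη : ConvergesTo x η := ⟨hasym 0, rfl⟩
  have hfix : ∀ s : ℕ, p ^ s • η = η := by
    intro s
    refine ((hxη.eq_of_asymptotic (hxη.smul (p ^ s)) ?_)).symm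
    convert hasym s using 2 with n
    simp only [x, ← mul_smul, ← pow_add, add_comm]
  -- If `η = ζ`, then `d(o, x N) - β (x N)` would be large, whereas the escaping chain from `o`
  -- bounds it.
  have hηζ : η ≠ ζ := by
    intro e
    obtain ⟨N, hN⟩ := ((e ▸ hxη : ConvergesTo x ζ).asymptotic hz).exists_le o
      (dist o (p • o) + δ + 1)
    have h1 : Tendsto (fun m => gromovProduct o (x N) (z m)) U
        (𝓝 ((dist o (x N) - β (x N)) / 2)) := by
      refine (((h.tendsto (x N)).const_sub (dist o (x N))).div_const 2).congr fun m => ?_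
      simp only [gromovProduct]
      ring
    have h2 := ge_of_tendsto h1 (by
      filter_upwards [h.le_atTop (eventually_ge_atTop N)] with m hm using hN N m le_rfl hm)
    have h3 := hch N 0
    simp only [zero_add, horoProduct] at h3
    simp only [x, pow_zero, one_smul, h.apply_base] at h3 h2
    linarith
  have hηΛ : η ∈ limitSet Γ X \ {ζ} := ⟨⟨o, fun n => p ^ n, hxη⟩, hηζ⟩
  have hfin := hζ.2.2.1 {η} {η} isCompact_singleton isCompact_singleton
    (by simpa using hηΛ) (by simpa using hηΛ)
  have hmono : StrictMono fun n => β (x n) := strictMono_nat_of_lt_succ fun n => by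
    linarith [hx n]
  have hinj : Function.Injective fun n : ℕ => p ^ n := fun m n e =>
    hmono.injective (by simp only [x]; rw [show p ^ m = p ^ n from e])
  refine infinite_range_of_injective hinj (hfin.subset ?_)
  rintro _ ⟨n, rfl⟩
  exact ⟨pow_mem hp n, η, by simp [hfix n], rfl⟩

/-- The stabilizer of a bounded parabolic point coarsely preserves its horofunctions. -/
theorem IsHorofunction.abs_smul_sub_le_of_isBoundedParabolic (hδ : FourPoint X δ)
    (h : IsHorofunction o z U β) (hz : ConvergesTo z ζ) (hζ : IsBoundedParabolic Γ ζ) {p : Γ}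
    (hp : p ∈ MulAction.stabilizer Γ ζ) (x : X) : |β (p • x) - β x| ≤ 7 * δ + 1 := by
  have hδ0 := hδ.nonneg o
  have hb := h.apply_base
  have h1 := h.apply_smul_le_of_isBoundedParabolic hδ hz hζ hp
  have h2 := h.apply_smul_le_of_isBoundedParabolic hδ hz hζ (inv_mem hp)
  have h3 := h.smul_sub_smul_le hδ hz hp (p⁻¹ • o) o
  have h4 := h.smul_sub_smul_le hδ hz hp o (p⁻¹ • o)
  have h5 := h.smul_sub_smul_le hδ hz hp x o
  have h6 := h.smul_sub_smul_le hδ hz hp o x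
  rw [smul_inv_smul] at h3 h4
  rw [abs_le]
  constructor <;> linarith

end Stabilizer

/-! ### Orbits avoid a horoball -/

section Orbit

variable {X Γ : Type*} [MetricSpace X] [IsGromovHyperbolic X] [Group Γ] [MulAction Γ X]
  [IsIsometricSMul Γ X] {o : X} {z : ℕ → X} {U : Filter ℕ} {β : X → ℝ} {ζ : Boundary X} {δ : ℝ}

/-- A point `y` close to a line from `η` to `ζ` that passes near `o` is either not deep in the
horoballs at `ζ` or close to a ray from `o` to `ζ`. -/
theorem IsHorofunction.le_or_add_dist_le (hδ : FourPoint X δ) (h : IsHorofunction o z U β)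
    (hz : ConvergesTo z ζ) {η : Boundary X} {y : X} {R C : ℝ}
    (hR : ¬ BoundaryNear o R ζ η) (hC : ¬ BoundaryNear y C ζ η) :
    -(2 * R + 2 * C + 10 * δ) ≤ β y ∨ β y + dist o y ≤ 2 * C + 6 * δ := by
  have := h.neBot
  obtain ⟨u, hu⟩ := exists_convergesTo η
  obtain ⟨N, hN⟩ := exists_gromovProduct_le_of_not_boundaryNear hδ hR hz hu
  obtain ⟨M, hM⟩ := exists_gromovProduct_le_of_not_boundaryNear hδ hC hz hu
  by_contra! hc
  have h1 := (h.tendsto y).eventually_lt_const hc.1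
  have h2 := (h.tendsto y).eventually_const_lt
    (show 2 * C + 6 * δ - dist o y < β y by linarith [hc.2])
  obtain ⟨m, h1, h2, h3⟩ :=
    (h1.and (h2.and (h.le_atTop (eventually_ge_atTop (max N M))))).exists
  have e1 := hN m (max N M) ((le_max_left _ _).trans h3) (le_max_left _ _)
  have e2 := hM m (max N M) ((le_max_right _ _).trans h3) (le_max_right _ _)
  -- As `(z | u)_y` is small, `y` is near the ray from `o` to `ζ` or the one from `o` to `η`; the
  -- latter does not go deep.
  have e3 := hδ y (z m) o (u (max N M))
  have e4 : min (gromovProduct y (z m) o) (gromovProduct y o (u (max N M))) ≤ C + 3 * δ := by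
    linarith
  have e5 := dist_triangle (z m) y (u (max N M))
  have e6 : 0 ≤ dist o y := dist_nonneg
  simp only [gromovProduct] at e1 e4
  rcases min_le_iff.1 e4 with e | e
  · linarith [dist_comm y o, dist_comm (z m) o]
  · linarith [dist_comm y o, dist_comm (z m) y]

/-- Two limit points separated as seen from `o` cannot both be near `γ⁻¹ • ζ`. So some line from `ζ`
to a limit point passes near `γ • o`, and cocompactness moves its other end into `K`. -/
theorem exists_not_boundaryNear_smul (o : X)
    {ξ₁ ξ₂ : Boundary X} (h1 : ξ₁ ∈ limitSet Γ X) (h2 : ξ₂ ∈ limitSet Γ X) (hne : ξ₁ ≠ ξ₂)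
    {K : Set (Boundary X)}
    (hK : limitSet Γ X \ {ζ} ⊆ ⋃ g ∈ MulAction.stabilizer Γ ζ, (fun η => g • η) '' K) :
    ∃ C, ∀ γ : Γ, ∃ p ∈ MulAction.stabilizer Γ ζ, ∃ η ∈ K,
      ¬ BoundaryNear (p • γ • o) C ζ η := by
  obtain ⟨δ, hδ⟩ : ∃ δ, FourPoint X δ := IsGromovHyperbolic.exists_delta
  obtain ⟨R, hR⟩ := exists_not_boundaryNear o hne
  refine ⟨R + δ, fun γ => ?_⟩
  obtain ⟨ξ, hξ, hn⟩ : ∃ ξ ∈ limitSet Γ X, ¬ BoundaryNear o (R + δ) (γ⁻¹ • ζ) ξ := by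
    by_contra! hc
    exact hR (((hc ξ₁ h1).symm.trans hδ (hc ξ₂ h2)).mono (by linarith))
  have hn' : ¬ BoundaryNear (γ • o) (R + δ) ζ (γ • ξ) := fun hc =>
    hn (by simpa using hc.smul γ⁻¹)
  have hne' : γ • ξ ≠ ζ := fun e => hn' (e ▸ BoundaryNear.refl _ _ _)
  obtain ⟨p, hp, η, hη, hpη⟩ := mem_iUnion₂.1 (hK ⟨smul_mem_limitSet γ hξ, hne'⟩)
  refine ⟨p⁻¹, inv_mem hp, η, hη, fun hc => hn' ?_⟩
  have := hc.smul p
  rw [smul_inv_smul, MulAction.mem_stabilizer_iff.1 hp] at this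
  exact hpη ▸ this

/-- The orbit of `o` avoids a horoball centered at the bounded parabolic point `ζ`. -/
theorem IsHorofunction.exists_le_apply_smul [ProperSpace X] [ProperlyDiscontinuousSMul Γ X]
    (hδ : FourPoint X δ) (h : IsHorofunction o z U β)
    (hz : ConvergesTo z ζ) (hζ : IsBoundedParabolic Γ ζ) (hne : IsNonelementary Γ X) :
    ∃ B, ∀ γ : Γ, -B ≤ β (γ • o) := by
  obtain ⟨K, hKc, hKΛ, hK⟩ := hζ.2.2.2
  obtain ⟨ξ₁, h1, ξ₂, h2, h12⟩ : (limitSet Γ X).Nontrivial :=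
    one_lt_encard_iff_nontrivial.1 (lt_trans (by norm_num) hne)
  obtain ⟨C, hC⟩ := exists_not_boundaryNear_smul o h1 h2 h12 hK
  obtain ⟨R, hR⟩ := exists_forall_not_boundaryNear_of_isCompact o hKc
    (fun hmem => (hKΛ hmem).2 rfl)
  set E := 7 * δ + 1
  set c := max (2 * C + 6 * δ) 0
  set F : Set Γ := {g | dist o (g • o) ≤ 3 * E + c + 4 * δ}
  have hF : F.Finite := by
    refine (ProperlyDiscontinuousSMul.finite_disjoint_inter_image (Γ := Γ)
      (isCompact_singleton (x := o))
      (isCompact_closedBall o (3 * E + c + 4 * δ))).subset fun g hg => ?_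
    refine ⟨g • o, ⟨o, rfl, rfl⟩, ?_⟩
    rw [Metric.mem_closedBall, dist_comm]
    exact hg
  -- One more stabilizer element than `F` can hold; conjugation by `q * γ` will inject `t` into `F`.
  obtain ⟨t, htQ, htc⟩ := hζ.2.1.exists_subset_card_eq (hF.toFinset.card + 1)
  obtain ⟨T, hT⟩ := (t.image fun p : Γ => dist o (p • o)).bddAbove
  have hT' : ∀ p ∈ t, dist o (p • o) ≤ T := fun p hp =>
    hT (Finset.mem_coe.2 (Finset.mem_image_of_mem _ hp))
  by_contra! hc
  -- `E` is lost in moving by `q`, `T` makes the point deep compared with the displacement of `o` by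
  -- `t`, and the last term forces closeness to the ray.
  obtain ⟨γ, hγ⟩ := hc (E + max T (2 * R + 2 * C + 10 * δ))
  obtain ⟨q, hq, η, hη, hnear⟩ := hC γ
  set y := q • γ • o with hy
  have hEq := abs_le.1 (h.abs_smul_sub_le_of_isBoundedParabolic hδ hz hζ hq (γ • o))
  have hβy : β y < -max T (2 * R + 2 * C + 10 * δ) := by linarith [hEq.2]
  have hyray : β y + dist o y ≤ c := by
    rcases h.le_or_add_dist_le hδ hz (hR η hη) hnear with e | e
    · linarith [le_max_right T (2 * R + 2 * C + 10 * δ)]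
    · exact e.trans (le_max_left _ _)
  have hmaps : ∀ p ∈ t, (q * γ)⁻¹ * p * (q * γ) ∈ hF.toFinset := by
    intro p hp
    rw [Finite.mem_toFinset]
    have hd := h.dist_smul_le hδ
      (fun x => h.abs_smul_sub_le_of_isBoundedParabolic hδ hz hζ (htQ hp) x) hyray
      (le_max_right _ _) (by linarith [hT' p hp, le_max_left T (2 * R + 2 * C + 10 * δ)])
    change dist o (((q * γ)⁻¹ * p * (q * γ)) • o) ≤ _
    rw [← dist_smul (q * γ)]
    simpa only [mul_smul, smul_inv_smul, mul_assoc, mul_inv_rev, ← hy] using hd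
  have := Finset.card_le_card_of_injOn (fun p => (q * γ)⁻¹ * p * (q * γ)) hmaps
    (fun a _ b _ e => by simpa using e)
  omega

end Orbit

/-! ### Displacement against word length -/

section WordNorm

variable {Γ : Type*} [Group Γ]

theorem exists_list_length_eq_wordNorm {S : Set Γ} (hS : Subgroup.closure S = ⊤) (g : Γ) :
    ∃ l : List Γ, (∀ s ∈ l, s ∈ S ∨ s⁻¹ ∈ S) ∧ l.prod = g ∧ l.length = wordNorm S g := by
  obtain ⟨l, hl, hg⟩ := Submonoid.exists_list_of_mem_closure (s := S ∪ S⁻¹) (x := g)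
    (by rw [← Subgroup.closure_toSubmonoid, hS]; trivial)
  exact Nat.sInf_mem
    (s := {n | ∃ l : List Γ, (∀ s ∈ l, s ∈ S ∨ s⁻¹ ∈ S) ∧ l.prod = g ∧ l.length = n})
    ⟨l.length, l, hl, hg, rfl⟩

/-- Displacement is at most logarithmic in the word norm. -/
theorem IsHorofunction.dist_smul_le_clog_wordNorm {X : Type*} [MetricSpace X]
    [MulAction Γ X] [IsIsometricSMul Γ X] {o : X} {z : ℕ → X} {U : Filter ℕ} {β : X → ℝ} {δ B L : ℝ}
    (hδ : FourPoint X δ) (h : IsHorofunction o z U β) (hB : ∀ γ : Γ, -B ≤ β (γ • o))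
    {S : Set Γ} (hS : Subgroup.closure S = ⊤) (hL0 : 0 ≤ L) (hL : ∀ s ∈ S, dist o (s • o) ≤ L)
    (g : Γ) :
    dist o (g • o) ≤ β (g • o) + 2 * B + L + 2 * δ * Nat.clog 2 (wordNorm S g) := by
  obtain ⟨l, hl, hg, hn⟩ := exists_list_length_eq_wordNorm hS g
  let f : ℕ → X := fun i => (l.take i).prod • o
  have hstep : ∀ i, dist (f i) (f (i + 1)) ≤ L := by
    intro i
    rcases lt_or_ge i l.length with hi | hi
    · simp only [f]
      rw [List.prod_take_succ l i hi, mul_smul, dist_smul]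
      rcases hl _ (List.getElem_mem hi) with hs | hs
      · exact hL _ hs
      · have := hL _ hs
        rwa [← dist_smul (l[i]), smul_inv_smul, dist_comm] at this
    · simp only [f]
      rw [List.take_of_length_le hi, List.take_of_length_le (by omega), dist_self]
      exact hL0
  -- Consecutive prefixes have `β ≥ -B` and distance at most `L`.
  have hch := h.le_horoProduct_chain hδ (A := -B - L / 2) f
    (fun i => by linarith [hB (l.take i).prod])
    (fun i => by
      have h1 := hB (l.take i).prod
      have h2 := hB (l.take (i + 1)).prod
      have h3 := hstep i
      unfold horoProduct
      simp only [f] at *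
      linarith)
    (Nat.clog 2 l.length) 0 l.length (Nat.le_pow_clog (by norm_num) _)
  simp only [f, zero_add, List.take_zero, List.prod_nil, one_smul, List.take_length, hg,
    horoProduct, h.apply_base] at hch
  rw [hn] at hch
  linarith

end WordNorm

end GromovHyp

/-! ### Exponentiating the logarithmic bound -/

open GromovHyp in
theorem mainTheorem10 {X Γ : Type*} [MetricSpace X] [ProperSpace X]
    [GromovHyp.IsGeodesicSpace X] [GromovHyp.IsGromovHyperbolic X]
    [Group Γ] [MulAction Γ X] [IsIsometricSMul Γ X] [ProperlyDiscontinuousSMul Γ X]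
    (hne : GromovHyp.IsNonelementary Γ X)
    (hgf : GromovHyp.IsGeometricallyFinite Γ X)
    (S : Set Γ) (hSfin : S.Finite) (hSgen : Subgroup.closure S = ⊤)
    (o : X) (P : Subgroup Γ) (hP : GromovHyp.IsParabolicSubgroup X P) :
    ∃ c D : ℝ, 1 < c ∧ 0 < D ∧
      ∀ g ∈ P, g ≠ 1 → D * c ^ dist o (g • o) ≤ (GromovHyp.wordNorm S g : ℝ) := by
  obtain ⟨δ, hδ⟩ : ∃ δ, FourPoint X δ := IsGromovHyperbolic.exists_delta
  obtain ⟨ζ, hζ, hPζ⟩ := hP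
  obtain ⟨z, hz⟩ := exists_convergesTo ζ
  obtain ⟨U, β, h⟩ := exists_isHorofunction o z
  obtain ⟨B, hB⟩ := h.exists_le_apply_smul (Γ := Γ) hδ hz hζ hne
  obtain ⟨L, hL⟩ := (hSfin.image fun s => dist o (s • o)).bddAbove
  have hδ0 := hδ.nonneg o
  set C := 7 * δ + 1 + 2 * B + max L 0
  have hmain : ∀ g ∈ P, dist o (g • o) ≤ C + 2 * (δ + 1) * Nat.clog 2 (wordNorm S g) := by
    intro g hg
    have h1 := h.dist_smul_le_clog_wordNorm hδ hB hSgen (le_max_right L 0)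
      (fun s hs => (hL (mem_image_of_mem _ hs)).trans (le_max_left L 0)) g
    have h2 := (abs_le.1 (h.abs_smul_sub_le_of_isBoundedParabolic hδ hz hζ (hPζ hg) o)).2
    rw [h.apply_base] at h2
    have h3 : (0 : ℝ) ≤ Nat.clog 2 (wordNorm S g) := Nat.cast_nonneg _
    linarith
  -- Using `δ + 1` keeps the inverse positive when `δ = 0`.
  set a : ℝ := (2 * (δ + 1))⁻¹ with ha
  have ha0 : 0 < a := by positivity
  refine ⟨2 ^ a, (2 * 2 ^ (a * C))⁻¹, Real.one_lt_rpow one_lt_two ha0, by positivity,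
    fun g hg hg1 => ?_⟩
  -- The bound `2 ^ clog n ≤ 2 * n` fails at `n = 0`, hence the restriction to `g ≠ 1`.
  have hn : wordNorm S g ≠ 0 := by
    intro h0
    obtain ⟨l, -, hlg, hl⟩ := exists_list_length_eq_wordNorm hSgen g
    rw [h0, List.length_eq_zero_iff] at hl
    exact hg1 (by rw [← hlg, hl, List.prod_nil])
  have hpow : (2 : ℝ) ^ Nat.clog 2 (wordNorm S g) ≤ 2 * wordNorm S g := by
    have : 2 ^ Nat.clog 2 (wordNorm S g) ≤ 2 * wordNorm S g := by
      rcases Nat.lt_or_ge 1 (wordNorm S g) with h1 | h1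
      · have h2 := Nat.pow_pred_clog_lt_self one_lt_two h1
        have h3 := Nat.clog_pos one_lt_two h1
        have h4 : 2 ^ Nat.clog 2 (wordNorm S g) = 2 * 2 ^ (Nat.clog 2 (wordNorm S g)).pred := by
          rw [← pow_succ', ← Nat.succ_eq_add_one, Nat.succ_pred_eq_of_pos h3]
        omega
      · rw [Nat.clog_of_right_le_one h1]
        omega
    exact_mod_cast this
  rw [inv_mul_le_iff₀ (by positivity), ← Real.rpow_mul zero_le_two]
  calc (2 : ℝ) ^ (a * dist o (g • o))
      ≤ 2 ^ (a * C + Nat.clog 2 (wordNorm S g)) := by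
        refine Real.rpow_le_rpow_of_exponent_le one_le_two ?_
        have := mul_le_mul_of_nonneg_left (hmain g hg) ha0.le
        rwa [mul_add, ← mul_assoc, ha, inv_mul_cancel₀ (by positivity), one_mul] at this
    _ = 2 ^ (a * C) * 2 ^ Nat.clog 2 (wordNorm S g) := by
        rw [Real.rpow_add two_pos, Real.rpow_natCast]
    _ ≤ 2 ^ (a * C) * (2 * wordNorm S g) := by gcongr
    _ = 2 * 2 ^ (a * C) * wordNorm S g := by ring
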